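/- Let a state consist of $2048$ bits: $128$ inner bits $i$ followed by $1920$ outer bits $o$. For a permutation $\pi$ of the set of states, the Randen generator with its permutation replaced by $\pi$ works as follows: a call of $\mathtt{Generate}$ replaces the current state $(i,o)$ by $(a\oplus i,\,b)$, where $(a,b)=\pi(i,o)$, and outputs $b\in\{0,1\}^{1920}$. A distinguisher is a deterministic, adaptive, computationally unbounded algorithm that may, in any order, ask the generator for its next output (generator queries) and evaluate $\pi$ or $\pi^{-1}$ at states of its choice (permutation queries), and that finally returns $0$ or $1$. In both experiments $\pi$ is a uniformly random permutation of the $2^{2048}$ states. In the real experiment the initial state is drawn from a distribution $D$, independently of $\pi$, and generator queries are answered by successive calls of $\mathtt{Generate}$; in the ideal experiment they are answered by independent uniform elements of $\{0,1\}^{1920}$, independent of $\pi$. Let $\mathrm{Adv}_D(A)$ be the absolute difference of the probabilities that $A$ returns $1$ in the two experiments. Let $q$ and $\ell$ be the maximal numbers of permutation queries and of generator queries that $A$ makes, over all possible sequences of answers. Then the generator is indistinguishable from random by adversaries limited to $2^{64}$ queries, in the following concrete sense. 1. If $D$ is the uniform distribution on all states, then every $A$ with $q\le 2^{64}$ and $\ell\le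 2^{64}$ has $\mathrm{Adv}_D(A)\le 2^{-62}$. 2. If the permutation is secret ($q=0$), then for every $D$ (in particular for every fixed initial state) every $A$ with $\ell\le 2^{64}$ has $\mathrm{Adv}_D(A)\le 2^{-1792}$. 3. In general, if $D$ gives every single state probability at most $\delta$, then for every $A$ $$\mathrm{Adv}_D(A)\le q\left(\delta+2^{-127}\right)+\frac{\ell^2}{2^{1920}}.$$ -/

import Mathlib

/-- A generator state: `c` inner (capacity) bits, followed by `r` outer bits. -/
abbrev GenState (c r : ℕ) : Type := BitVec c × BitVec r

/-- One call of `Generate` with the permutation `π`: apply `π` to the whole state, then XOR the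
inner bits with the value they had before. The outer bits of the new state are the output. -/
def generateStep {c r : ℕ} (π : Equiv.Perm (GenState c r)) (s : GenState c r) : GenState c r :=
  ((π s).1 ^^^ s.1, (π s).2)

/-- A deterministic, adaptive, computationally unbounded adversary, as its decision tree.
At each node it stops with a verdict (`true` stands for 1), or asks the generator for its next
`r`-bit output, or evaluates the permutation, or evaluates the inverse of the permutation; it
then continues in a way that depends on the answer. -/
inductive Adversary (c r : ℕ) : Type
  | verdict (b : Bool) : Adversary c r
  | next (k : BitVec r → Adversary c r) : Adversary c r
  | forward (x : GenState c r) (k : GenState c r → Adversary c r) : Adversary c r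
  | backward (y : GenState c r) (k : GenState c r → Adversary c r) : Adversary c r

namespace Adversary

variable {c r : ℕ}

/-- The largest number of direct permutation queries (in either direction), over all possible
sequences of answers. -/
noncomputable def permQueries : Adversary c r → ℕ
  | verdict _ => 0
  | next k => ⨆ o, permQueries (k o)
  | forward _ k => (⨆ y, permQueries (k y)) + 1
  | backward _ k => (⨆ x, permQueries (k x)) + 1

/-- The largest number of generator queries, over all possible sequences of answers. -/
noncomputable def genQueries : Adversary c r → ℕ
  | verdict _ => 0
  | next k => (⨆ o, genQueries (k o)) + 1
  | forward _ k => ⨆ y, genQueries (k y)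
  | backward _ k => ⨆ x, genQueries (k x)

/-- The verdict when the generator is the real one, with permutation `π` and current state `s`. -/
def runReal (π : Equiv.Perm (GenState c r)) : Adversary c r → GenState c r → Bool
  | verdict b, _ => b
  | next k, s => runReal π (k (generateStep π s).2) (generateStep π s)
  | forward x k, s => runReal π (k (π x)) s
  | backward y k, s => runReal π (k (π.symm y)) s

/-- The verdict when the generator is the ideal one: every output is a fresh uniform string,
independent of everything else. -/
noncomputable def runIdeal (π : Equiv.Perm (GenState c r)) : Adversary c r → PMF Bool
  | verdict b => PMF.pure b
  | next k => (PMF.uniformOfFintype (BitVec r)).bind fun o => runIdeal π (k o)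
  | forward x k => runIdeal π (k (π x))
  | backward y k => runIdeal π (k (π.symm y))

/-- The real experiment: uniformly random permutation, independent initial state drawn from
`init`. -/
noncomputable def realGame (init : PMF (GenState c r)) (A : Adversary c r) : PMF Bool :=
  (PMF.uniformOfFintype (Equiv.Perm (GenState c r))).bind fun π =>
    init.map fun s => A.runReal π s

/-- The ideal experiment: uniformly random permutation, ideal generator. -/
noncomputable def idealGame (A : Adversary c r) : PMF Bool :=
  (PMF.uniformOfFintype (Equiv.Perm (GenState c r))).bind fun π => A.runIdeal π

/-- The distinguishing advantage. -/
noncomputable def advantage (init : PMF (GenState c r)) (A : Adversary c r) : ℝ :=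
  |(A.realGame init true).toReal - (A.idealGame true).toReal|

end Adversary

/-!
Everything follows from one inequality, for `c` inner and `r` outer bits and arbitrary `q`, `ℓ`:
the advantage is at most `q (δ + 2 / 2 ^ c) + ℓ (ℓ + 1) / 2 / 2 ^ r`.

The proof compares the two experiments transcript by transcript (the H-coefficient method). Extend
the transcript of the ideal experiment by an initial state and, for every output `o`, by a uniform
inner half `a` of the answer. This determines the states that the real generator would have gone
through and the answers `(a, o)` of the permutation there. Let `L` be the list of pairs
`(x, π x)` that the permutation queries reveal, and `M` the list of pairs (state, answer) of the
generator. Call the transcript good (`GoodTranscript`) if `L` and `M` share no argument and no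
value, and no argument and no value is repeated in `M`.

* A good transcript is at least as likely in the real experiment as in the ideal one: a random
  permutation extends `L ++ M` with probability at least `N⁻¹ ^ |M|` times the probability that it
  extends `L`, where `N` is the number of states (`sum_extends_le`, by composing with a
  transposition). `sum_idealExpect_good_le` carries this through the decision tree.
* A transcript is bad with small probability in the ideal experiment. There the inner halves are
  independent of everything the adversary sees, so they can be averaged with `L` and the outputs
  fixed. If the outer bits of the initial state and of all outputs are distinct, then nothing is
  repeated in `M`, and each pair of `L` meets `M` with probability at most `2 / 2 ^ c`, apart from
  the event that its argument is the initial state, which has probability at most `δ`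
  (`chainExpect_not_good_le`). The outer bits fail to be distinct with probability at most
  `ℓ (ℓ + 1) / 2 / 2 ^ r` (`idealExpect_not_nodup_le`).

Hence each verdict is less likely in the real experiment by at most the probability of a bad
transcript; applied to both verdicts, this bounds the absolute difference.
-/

open scoped BigOperators

/-! ### Indicators and averages -/

open scoped Classical in
/-- The real-valued indicator of a proposition. -/
noncomputable def ind (p : Prop) : ℝ := if p then 1 else 0

lemma ind_nonneg (p : Prop) : 0 ≤ ind p := by unfold ind; split_ifs <;> norm_num

lemma ind_le_one (p : Prop) : ind p ≤ 1 := by unfold ind; split_ifs <;> norm_num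

lemma ind_of {p : Prop} (h : p) : ind p = 1 := if_pos h

lemma ind_of_not {p : Prop} (h : ¬p) : ind p = 0 := if_neg h

lemma ind_mono {p q : Prop} (h : p → q) : ind p ≤ ind q := by
  by_cases hp : p
  · rw [ind_of hp, ind_of (h hp)]
  · rw [ind_of_not hp]; exact ind_nonneg q

lemma ind_le_add {p q t : Prop} (h : p → q ∨ t) : ind p ≤ ind q + ind t := by
  by_cases hp : p
  · rcases h hp with hq | ht
    · rw [ind_of hq]; linarith [ind_le_one p, ind_nonneg t]
    · rw [ind_of ht]; linarith [ind_le_one p, ind_nonneg q]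
  · rw [ind_of_not hp]; linarith [ind_nonneg q, ind_nonneg t]

lemma sum_ind_eq_mul {α : Type*} [Fintype α] (a : α) (f : α → ℝ) :
    ∑ b, ind (a = b) * f b = f a := by
  rw [Finset.sum_eq_single a]
  · rw [ind_of rfl, one_mul]
  · intro b _ hb
    rw [ind_of_not (Ne.symm hb), zero_mul]
  · simp

lemma expect_ind_eq {α : Type*} [Fintype α] (a : α) :
    𝔼 b, ind (b = a) = (Fintype.card α : ℝ)⁻¹ := by
  have h := sum_ind_eq_mul a fun _ => 1
  simp only [mul_one, eq_comm (a := a)] at h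
  rw [Fintype.expect_eq_sum_div_card, h, one_div]

lemma expect_mono {α : Type*} [Fintype α] {f g : α → ℝ} (h : ∀ a, f a ≤ g a) :
    𝔼 a, f a ≤ 𝔼 a, g a :=
  Finset.expect_le_expect fun a _ => h a

lemma card_bitVec (n : ℕ) : (Fintype.card (BitVec n) : ℝ) = 2 ^ n := by
  rw [← FinEnum.card_eq_fintypeCard, FinEnum.card_bitVec]
  push_cast
  rfl

lemma expect_ind_mem_le {r : ℕ} (P : List (BitVec r)) :
    𝔼 o, ind (o ∈ P) ≤ P.length / 2 ^ r := by
  induction P with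
  | nil => simp [ind]
  | cons p P ih =>
    calc 𝔼 o, ind (o ∈ p :: P) ≤ 𝔼 o, (ind (o = p) + ind (o ∈ P)) :=
          expect_mono fun o => ind_le_add List.mem_cons.mp
      _ = (2 ^ r)⁻¹ + 𝔼 o, ind (o ∈ P) := by
          rw [Finset.expect_add_distrib, expect_ind_eq, card_bitVec]
      _ ≤ (2 ^ r)⁻¹ + P.length / 2 ^ r := by gcongr
      _ = (p :: P).length / 2 ^ r := by rw [List.length_cons]; push_cast; ring

lemma toReal_uniform_bind {α β : Type*} [Fintype α] [Nonempty α] (f : α → PMF β) (b : β) :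
    (((PMF.uniformOfFintype α).bind f) b).toReal = 𝔼 a, (f a b).toReal := by
  rw [PMF.bind_apply, tsum_fintype, ENNReal.toReal_sum
    fun a _ => ENNReal.mul_ne_top (PMF.apply_ne_top _ _) (PMF.apply_ne_top _ _),
    Fintype.expect_eq_sum_div_card, Finset.sum_div]
  refine Finset.sum_congr rfl fun a _ => ?_
  rw [ENNReal.toReal_mul, PMF.uniformOfFintype_apply, ENNReal.toReal_inv, ENNReal.toReal_natCast]
  ring

lemma toReal_map_apply {α β : Type*} [Fintype α] (p : PMF α) (f : α → β) (b : β) :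
    ((p.map f) b).toReal = ∑ a, (p a).toReal * ind (f a = b) := by
  rw [PMF.map_apply, tsum_fintype, ENNReal.toReal_sum]
  · refine Finset.sum_congr rfl fun a _ => ?_
    by_cases h : f a = b
    · rw [if_pos h.symm, ind_of h, mul_one]
    · rw [if_neg (Ne.symm h), ind_of_not h, mul_zero, ENNReal.toReal_zero]
  · intro a _
    split_ifs
    exacts [PMF.apply_ne_top _ _, ENNReal.zero_ne_top]

lemma sum_toReal_pmf {α : Type*} [Fintype α] (p : PMF α) : ∑ a, (p a).toReal = 1 := by
  rw [← ENNReal.toReal_sum fun a _ => PMF.apply_ne_top _ _, ← tsum_fintype (L := .unconditional α),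
    p.tsum_coe, ENNReal.toReal_one]

/-! ### Permutations extending a list of pairs -/

/-- The permutation `π` maps the first entry of each pair of `L` to the second. -/
def Extends {S : Type*} (L : List (S × S)) (π : Equiv.Perm S) : Prop :=
  ∀ p ∈ L, π p.1 = p.2

lemma extends_append {S : Type*} {L M : List (S × S)} {π : Equiv.Perm S} :
    Extends (L ++ M) π ↔ Extends L π ∧ Extends M π :=
  List.forall_mem_append

lemma extends_singleton {S : Type*} {x y : S} {π : Equiv.Perm S} :
    Extends [(x, y)] π ↔ π x = y := by simp [Extends]

/-- Splitting a sum over the permutations that extend `L` by the answer `e π` to a further query.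
For a forward query at `x` the pair `p t` is `(x, t)`, for a backward query at `y` it is
`(t, y)`. -/
lemma sum_extends_split {S : Type*} [Fintype S] [DecidableEq S] (L : List (S × S))
    (e : Equiv.Perm S → S) (p : S → S × S) (hp : ∀ π t, e π = t ↔ π (p t).1 = (p t).2)
    (f : Equiv.Perm S → S → ℝ) :
    ∑ π, ind (Extends L π) * f π (e π) = ∑ t, ∑ π, ind (Extends (L ++ [p t]) π) * f π t := by
  rw [Finset.sum_comm]
  refine Finset.sum_congr rfl fun π _ => ?_
  rw [← sum_ind_eq_mul (e π) fun t => f π t, Finset.mul_sum]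
  refine Finset.sum_congr rfl fun t _ => ?_
  have h₃ : Extends [p t] π ↔ e π = t := extends_singleton.trans (hp π t).symm
  by_cases h₁ : Extends L π <;> by_cases h₂ : e π = t <;>
    simp [ind, extends_append, h₃, h₁, h₂]

/-- `L` lists pairs revealed by permutation queries, `M` the pairs (state, answer) of the
generator. The transcript is good if `M` repeats no argument and no value, and shares none
with `L`. -/
structure GoodTranscript {S : Type*} (L M : List (S × S)) : Prop where
  fst_ne : ∀ p ∈ L, ∀ m ∈ M, m.1 ≠ p.1
  snd_ne : ∀ p ∈ L, ∀ m ∈ M, m.2 ≠ p.2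
  nodup_fst : (M.map Prod.fst).Nodup
  nodup_snd : (M.map Prod.snd).Nodup

/-- Prescribing one more value costs at most a factor `|S|`: the permutations that send `s` to `w`
become permutations that send `s` to `z` by composition with the transposition of `w` and `z`. -/
lemma sum_extends_le_of_notMem {S : Type*} [Fintype S] [DecidableEq S] {L : List (S × S)} {s z : S}
    (hs : ∀ p ∈ L, s ≠ p.1) (hz : ∀ p ∈ L, z ≠ p.2) :
    ∑ π, ind (Extends L π) ≤ Fintype.card S * ∑ π, ind (Extends (L ++ [(s, z)]) π) := by
  have h := sum_extends_split L (· s) (fun t => (s, t)) (fun _ _ => Iff.rfl) fun _ _ => 1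
  simp only [mul_one] at h
  rw [h, ← nsmul_eq_mul]
  refine Finset.sum_le_card_nsmul _ _ _ fun w _ => ?_
  rw [← Equiv.sum_comp (Equiv.mulLeft (Equiv.swap z w))
    fun π => ind (Extends (L ++ [(s, z)]) π)]
  refine Finset.sum_le_sum fun π _ => ind_mono fun hπ => ?_
  obtain ⟨hL, hw⟩ := extends_append.mp hπ
  rw [extends_singleton] at hw
  refine extends_append.mpr ⟨fun p hp => ?_, ?_⟩
  · rw [Equiv.coe_mulLeft, Equiv.Perm.mul_apply, hL p hp]
    refine Equiv.swap_apply_of_ne_of_ne (hz p hp).symm fun hpw => hs p hp (π.injective ?_)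
    rw [hL p hp, hw, hpw]
  · rw [extends_singleton, Equiv.coe_mulLeft, Equiv.Perm.mul_apply, hw, Equiv.swap_apply_right]

lemma sum_extends_le {S : Type*} [Fintype S] [DecidableEq S] {L M : List (S × S)}
    (h : GoodTranscript L M) :
    ∑ π, ind (Extends L π) ≤ (Fintype.card S : ℝ) ^ M.length * ∑ π, ind (Extends (L ++ M) π) := by
  induction M generalizing L with
  | nil => simp
  | cons m M ih =>
    obtain ⟨h₁, h₂, h₃, h₄⟩ := h
    simp only [List.map_cons, List.nodup_cons, List.mem_map, not_exists, not_and] at h₃ h₄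
    have hg : GoodTranscript (L ++ [m]) M := by
      refine ⟨fun p hp m' hm' => ?_, fun p hp m' hm' => ?_, h₃.2, h₄.2⟩
      · rcases List.mem_append.mp hp with hp | hp
        · exact h₁ p hp m' (List.mem_cons_of_mem _ hm')
        · rw [List.mem_singleton.mp hp]; exact h₃.1 m' hm'
      · rcases List.mem_append.mp hp with hp | hp
        · exact h₂ p hp m' (List.mem_cons_of_mem _ hm')
        · rw [List.mem_singleton.mp hp]; exact h₄.1 m' hm'
    have step := sum_extends_le_of_notMem (s := m.1) (z := m.2)
      (fun p hp => h₁ p hp m List.mem_cons_self) (fun p hp => h₂ p hp m List.mem_cons_self)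
    calc ∑ π, ind (Extends L π)
        ≤ Fintype.card S * ∑ π, ind (Extends (L ++ [m]) π) := step
      _ ≤ Fintype.card S * ((Fintype.card S : ℝ) ^ M.length *
            ∑ π, ind (Extends (L ++ [m] ++ M) π)) := by gcongr; exact ih hg
      _ = _ := by
          rw [List.append_assoc, List.singleton_append, List.length_cons, pow_succ']; ring

/-! ### The hidden states of the generator -/

/-- A list of pairs (argument, value) of the permutation. -/
abbrev PairList (c r : ℕ) : Type := List (GenState c r × GenState c r)

/-- The average of `g` over the pairs (state, answer) of a generator that starts in the state `s`
and outputs the list `O`, when the inner half of each answer is uniform and independent. -/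
noncomputable def chainExpect {c r : ℕ} :
    List (BitVec r) → GenState c r → (PairList c r → ℝ) → ℝ
  | [], _, g => g []
  | o :: O, s, g => 𝔼 a : BitVec c, chainExpect O (a ^^^ s.1, o) fun M => g ((s, (a, o)) :: M)

section Chain

variable {c r : ℕ}

/-- For an upper bound it suffices to look at the lists of pairs that can occur: their answers have
outer bits `O`, and their states have outer bits from `s.2 :: O`. -/
lemma chainExpect_mono (O : List (BitVec r)) (s : GenState c r) {g g' : PairList c r → ℝ}
    (h : ∀ M : PairList c r, M.map (fun m => m.2.2) = O →
      (M.map fun m => m.1.2).Sublist (s.2 :: O) → g M ≤ g' M) :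
    chainExpect O s g ≤ chainExpect O s g' := by
  induction O generalizing s g g' with
  | nil => exact h [] rfl (by simp)
  | cons o O ih =>
    refine expect_mono fun a => ih _ fun M h₁ h₂ => h _ ?_ ?_
    · rw [List.map_cons, h₁]
    · exact h₂.cons_cons _

lemma chainExpect_const (O : List (BitVec r)) (s : GenState c r) (t : ℝ) :
    chainExpect O s (fun _ => t) = t := by
  induction O generalizing s with
  | nil => rfl
  | cons o O ih => simp only [chainExpect, ih]; exact Fintype.expect_const t

lemma chainExpect_add (O : List (BitVec r)) (s : GenState c r) (g g' : PairList c r → ℝ) :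
    chainExpect O s (fun M => g M + g' M) = chainExpect O s g + chainExpect O s g' := by
  induction O generalizing s g g' with
  | nil => rfl
  | cons o O ih => simp only [chainExpect, ih, Finset.expect_add_distrib]

/-- The number of pairs of `M` whose first entry is `x`. -/
noncomputable def fstHits (x : GenState c r) (M : PairList c r) : ℝ :=
  (M.map fun m => ind (m.1 = x)).sum

/-- The number of pairs of `M` whose second entry is `y`. -/
noncomputable def sndHits (y : GenState c r) (M : PairList c r) : ℝ :=
  (M.map fun m => ind (m.2 = y)).sum

lemma expect_ind_pair_le (e : BitVec c → BitVec c) (he : Function.Bijective e) (o : BitVec r)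
    (x : GenState c r) :
    𝔼 a, ind ((e a, o) = x) ≤ ind (o = x.2) * (2 ^ c)⁻¹ := by
  obtain ⟨i, u⟩ := x
  by_cases h : o = u
  · rw [ind_of (p := o = u) h, one_mul, ← card_bitVec, ← expect_ind_eq i]
    rw [← Fintype.expect_bijective e he (fun a => ind (e a = i)) (fun b => ind (b = i))
      fun _ => rfl]
    exact expect_mono fun a => ind_mono fun ha => congrArg Prod.fst ha
  · rw [ind_of_not (p := o = u) h, zero_mul]
    refine (expect_mono (g := fun _ => 0) fun a => ?_).trans_eq (by simp)
    rw [ind_of_not]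
    exact fun ha => h (congrArg Prod.snd ha)

lemma ind_add_count_cons (o u : BitVec r) (O : List (BitVec r)) :
    ind (o = u) + (O.count u : ℝ) = ((o :: O).count u : ℝ) := by
  by_cases h : o = u
  · rw [ind_of h, h, List.count_cons_self]; push_cast; ring
  · rw [ind_of_not h, List.count_cons_of_ne h]; ring

lemma chainExpect_fstHits_le (O : List (BitVec r)) (s x : GenState c r) :
    chainExpect O s (fstHits x) ≤ ind (s = x) + O.count x.2 * (2 ^ c)⁻¹ := by
  induction O generalizing s with
  | nil => simpa [chainExpect, fstHits] using ind_nonneg _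
  | cons o O ih =>
    have hxor : Function.Bijective fun a : BitVec c => a ^^^ s.1 :=
      Function.Involutive.bijective fun a => by simp
    calc chainExpect (o :: O) s (fstHits x)
        = 𝔼 a : BitVec c, (ind (s = x) + chainExpect O (a ^^^ s.1, o) (fstHits x)) := by
          refine Finset.expect_congr rfl fun a _ => ?_
          simp only [fstHits, List.map_cons, List.sum_cons, chainExpect_add, chainExpect_const]
          rfl
      _ ≤ 𝔼 a : BitVec c, (ind (s = x) +
            (ind ((a ^^^ s.1, o) = x) + O.count x.2 * (2 ^ c)⁻¹)) :=
          expect_mono fun a => by gcongr; exact ih _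
      _ = ind (s = x) +
            (𝔼 a : BitVec c, ind ((a ^^^ s.1, o) = x) + O.count x.2 * (2 ^ c)⁻¹) := by
          rw [Finset.expect_add_distrib, Finset.expect_add_distrib, Fintype.expect_const,
            Fintype.expect_const]
      _ ≤ ind (s = x) + (ind (o = x.2) * (2 ^ c)⁻¹ + O.count x.2 * (2 ^ c)⁻¹) := by
          gcongr; exact expect_ind_pair_le _ hxor o x
      _ = _ := by rw [← ind_add_count_cons]; ring

lemma chainExpect_sndHits_le (O : List (BitVec r)) (s y : GenState c r) :
    chainExpect O s (sndHits y) ≤ O.count y.2 * (2 ^ c)⁻¹ := by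
  induction O generalizing s with
  | nil => simp [chainExpect, sndHits]
  | cons o O ih =>
    calc chainExpect (o :: O) s (sndHits y)
        = 𝔼 a : BitVec c, (ind ((a, o) = y) + chainExpect O (a ^^^ s.1, o) (sndHits y)) := by
          refine Finset.expect_congr rfl fun a _ => ?_
          simp only [sndHits, List.map_cons, List.sum_cons, chainExpect_add, chainExpect_const]
          rfl
      _ ≤ 𝔼 a : BitVec c, (ind ((a, o) = y) + O.count y.2 * (2 ^ c)⁻¹) :=
          expect_mono fun a => by gcongr; exact ih _
      _ = 𝔼 a : BitVec c, ind ((a, o) = y) + O.count y.2 * (2 ^ c)⁻¹ := by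
          rw [Finset.expect_add_distrib, Fintype.expect_const]
      _ ≤ ind (o = y.2) * (2 ^ c)⁻¹ + O.count y.2 * (2 ^ c)⁻¹ := by
          gcongr; exact expect_ind_pair_le _ Function.bijective_id o y
      _ = _ := by rw [← ind_add_count_cons]; ring

/-- The expected number of coincidences between the queried pairs `L` and the pairs of the
generator. With distinct outputs, a queried state agrees in its outer bits with at most one of
them, and then it has one chance in `2 ^ c`. -/
lemma chainExpect_hits_le {O : List (BitVec r)} (hO : O.Nodup) (s : GenState c r)
    (L : PairList c r) :
    chainExpect O s (fun M => (L.map fun p => fstHits p.1 M + sndHits p.2 M).sum) ≤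
      (L.map fun p => ind (s = p.1)).sum + L.length * (2 / 2 ^ c) := by
  have hcount (u : BitVec r) : (O.count u : ℝ) * (2 ^ c)⁻¹ ≤ 1 * (2 ^ c)⁻¹ := by
    gcongr
    exact_mod_cast List.nodup_iff_count_le_one.mp hO u
  induction L with
  | nil => simp [chainExpect_const]
  | cons p L ih =>
    simp only [List.map_cons, List.sum_cons, chainExpect_add, List.length_cons]
    have h₁ := chainExpect_fstHits_le O s p.1
    have h₂ := chainExpect_sndHits_le O s p.2
    have h₃ := hcount p.1.2
    have h₄ := hcount p.2.2
    push_cast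
    rw [add_mul, div_eq_mul_inv] at *
    linarith

lemma one_le_hits {x : GenState c r} {f : GenState c r × GenState c r → GenState c r}
    {M : PairList c r} {m : GenState c r × GenState c r} (hm : m ∈ M) (h : f m = x) :
    1 ≤ (M.map fun m => ind (f m = x)).sum := by
  rw [← ind_of h]
  refine List.single_le_sum (fun t ht => ?_) _ (List.mem_map_of_mem hm)
  obtain ⟨m', -, rfl⟩ := List.mem_map.mp ht
  exact ind_nonneg _

lemma hits_nonneg (x : GenState c r) (f : GenState c r × GenState c r → GenState c r)
    (M : PairList c r) : 0 ≤ (M.map fun m => ind (f m = x)).sum := by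
  refine List.sum_nonneg fun t ht => ?_
  obtain ⟨m', -, rfl⟩ := List.mem_map.mp ht
  exact ind_nonneg _

/-- The probability of a bad transcript, given the initial state `s`, the queried pairs `L` and the
outputs `O`. -/
lemma chainExpect_not_good_le (O : List (BitVec r)) (s : GenState c r) (L : PairList c r) :
    chainExpect O s (fun M => ind (¬GoodTranscript L M)) ≤
      ind (¬(s.2 :: O).Nodup) + ((L.map fun p => ind (s = p.1)).sum +
        L.length * (2 / 2 ^ c)) := by
  by_cases hO : (s.2 :: O).Nodup
  · refine le_trans (chainExpect_mono O s fun M h₁ h₂ => ?_)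
      ((chainExpect_hits_le hO.of_cons s L).trans (le_add_of_nonneg_left (ind_nonneg _)))
    have hnn (p : GenState c r × GenState c r) : 0 ≤ fstHits p.1 M + sndHits p.2 M :=
      add_nonneg (hits_nonneg _ Prod.fst M) (hits_nonneg _ Prod.snd M)
    have hsum {p : GenState c r × GenState c r} (hp : p ∈ L) :
        fstHits p.1 M + sndHits p.2 M ≤ (L.map fun p => fstHits p.1 M + sndHits p.2 M).sum := by
      refine List.single_le_sum (fun t ht => ?_) _
        (List.mem_map_of_mem (f := fun p => fstHits p.1 M + sndHits p.2 M) hp)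
      obtain ⟨p', -, rfl⟩ := List.mem_map.mp ht
      exact hnn p'
    by_cases hg : GoodTranscript L M
    · rw [ind_of_not (not_not.mpr hg)]
      refine List.sum_nonneg fun t ht => ?_
      obtain ⟨p', -, rfl⟩ := List.mem_map.mp ht
      exact hnn p'
    · refine (ind_le_one _).trans (by_contra fun hlt => hg ⟨fun p hp m hm he => hlt ?_,
        fun p hp m hm he => hlt ?_, ?_, ?_⟩)
      · exact (le_add_of_le_of_nonneg (one_le_hits (f := Prod.fst) hm he)
          (hits_nonneg _ Prod.snd M)).trans (hsum hp)
      · exact (le_add_of_nonneg_of_le (hits_nonneg _ Prod.fst M)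
          (one_le_hits (f := Prod.snd) hm he)).trans (hsum hp)
      · refine List.Nodup.of_map Prod.snd ?_
        rw [List.map_map]
        exact hO.sublist h₂
      · refine List.Nodup.of_map Prod.snd ?_
        rw [List.map_map]
        exact h₁ ▸ hO.of_cons
  · rw [ind_of hO]
    have h₁ : chainExpect O s (fun M => ind (¬GoodTranscript L M)) ≤ 1 :=
      (chainExpect_mono O s fun M _ _ => ind_le_one _).trans_eq (chainExpect_const O s 1)
    refine h₁.trans (le_add_of_nonneg_right (add_nonneg (List.sum_nonneg fun t ht => ?_)
      (by positivity)))
    obtain ⟨p', -, rfl⟩ := List.mem_map.mp ht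
    exact ind_nonneg _

end Chain

namespace Adversary

variable {c r : ℕ}

/-! ### The ideal experiment with a fixed permutation -/

/-- The expectation of `f b L O` in the ideal experiment with the permutation `π`, where `b` is the
verdict, `L` lists the pairs `(x, π x)` that the permutation queries reveal, and `O` lists the
outputs of the generator. -/
noncomputable def idealExpect (π : Equiv.Perm (GenState c r)) :
    Adversary c r → (Bool → PairList c r → List (BitVec r) → ℝ) → ℝ
  | verdict b, f => f b [] []
  | next k, f => 𝔼 o, idealExpect π (k o) fun b L O => f b L (o :: O)
  | forward x k, f => idealExpect π (k (π x)) fun b L O => f b ((x, π x) :: L) O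
  | backward y k, f => idealExpect π (k (π.symm y)) fun b L O => f b ((π.symm y, y) :: L) O

lemma idealExpect_mono (π : Equiv.Perm (GenState c r)) (A : Adversary c r)
    {f g : Bool → PairList c r → List (BitVec r) → ℝ} (h : ∀ b L O, f b L O ≤ g b L O) :
    idealExpect π A f ≤ idealExpect π A g := by
  induction A generalizing f g with
  | verdict b => exact h _ _ _
  | next k ih => exact expect_mono fun o => ih o fun b L O => h _ _ _
  | forward x k ih => exact ih _ fun b L O => h _ _ _
  | backward y k ih => exact ih _ fun b L O => h _ _ _

lemma idealExpect_const (π : Equiv.Perm (GenState c r)) (A : Adversary c r) (t : ℝ) :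
    idealExpect π A (fun _ _ _ => t) = t := by
  induction A with
  | verdict b => rfl
  | next k ih => simp only [idealExpect, ih]; exact Fintype.expect_const t
  | forward x k ih => exact ih _
  | backward y k ih => exact ih _

lemma idealExpect_add (π : Equiv.Perm (GenState c r)) (A : Adversary c r)
    (f g : Bool → PairList c r → List (BitVec r) → ℝ) :
    idealExpect π A (fun b L O => f b L O + g b L O) =
      idealExpect π A f + idealExpect π A g := by
  induction A generalizing f g with
  | verdict b => rfl
  | next k ih => simp only [idealExpect, ih, Finset.expect_add_distrib]
  | forward x k ih => exact ih _ _ _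
  | backward y k ih => exact ih _ _ _

lemma idealExpect_sum {ι : Type*} [Fintype ι] (π : Equiv.Perm (GenState c r))
    (A : Adversary c r) (w : ι → ℝ) (f : ι → Bool → PairList c r → List (BitVec r) → ℝ) :
    idealExpect π A (fun b L O => ∑ i, w i * f i b L O) = ∑ i, w i * idealExpect π A (f i) := by
  induction A generalizing f with
  | verdict b => rfl
  | next k ih => simp only [idealExpect, ih, Finset.expect_sum_comm, Finset.mul_expect]
  | forward x k ih => exact ih _ _
  | backward y k ih => exact ih _ _

lemma idealExpect_const_mul (π : Equiv.Perm (GenState c r)) (A : Adversary c r) (t : ℝ)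
    (f : Bool → PairList c r → List (BitVec r) → ℝ) :
    idealExpect π A (fun b L O => t * f b L O) = t * idealExpect π A f := by
  simpa using idealExpect_sum π A (fun _ : Unit => t) fun _ => f

lemma idealExpect_expect {ι : Type*} [Fintype ι] (π : Equiv.Perm (GenState c r))
    (A : Adversary c r) (f : ι → Bool → PairList c r → List (BitVec r) → ℝ) :
    idealExpect π A (fun b L O => 𝔼 i, f i b L O) = 𝔼 i, idealExpect π A (f i) := by
  induction A generalizing f with
  | verdict b => rfl
  | next k ih =>
    simp only [idealExpect, ih]
    exact Finset.expect_comm _ _ _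
  | forward x k ih => exact ih _ _
  | backward y k ih => exact ih _ _

lemma toReal_runIdeal (π : Equiv.Perm (GenState c r)) (A : Adversary c r) (v : Bool) :
    (A.runIdeal π v).toReal = idealExpect π A fun b _ _ => ind (b = v) := by
  induction A with
  | verdict b =>
    by_cases h : b = v
    · simp [runIdeal, idealExpect, ind, h]
    · simp [runIdeal, idealExpect, ind, h, Ne.symm h]
  | next k ih => rw [runIdeal, toReal_uniform_bind]; simp only [ih, idealExpect]
  | forward x k ih => exact ih _
  | backward y k ih => exact ih _

lemma apply_le_iSup {α : Type*} [Finite α] (f : α → ℕ) (a : α) : f a ≤ ⨆ a, f a :=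
  le_ciSup (Set.finite_range f).bddAbove a

lemma idealExpect_length_le (π : Equiv.Perm (GenState c r)) (A : Adversary c r) :
    idealExpect π A (fun _ L _ => (L.length : ℝ)) ≤ A.permQueries := by
  induction A with
  | verdict b => simp [idealExpect]
  | next k ih =>
    refine (expect_mono fun o => (ih o).trans ?_).trans_eq (Fintype.expect_const _)
    exact_mod_cast apply_le_iSup (fun o => (k o).permQueries) o
  | forward x k ih =>
    simp only [idealExpect, permQueries, List.length_cons, Nat.cast_add, Nat.cast_one,
      idealExpect_add, idealExpect_const]
    gcongr
    refine (ih _).trans ?_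
    exact_mod_cast apply_le_iSup (fun y => (k y).permQueries) _
  | backward y k ih =>
    simp only [idealExpect, permQueries, List.length_cons, Nat.cast_add, Nat.cast_one,
      idealExpect_add, idealExpect_const]
    gcongr
    refine (ih _).trans ?_
    exact_mod_cast apply_le_iSup (fun x => (k x).permQueries) _

/-- A birthday bound: `n` fresh outputs meet each other or one of the `P.length` given strings. -/
lemma idealExpect_not_nodup_le (π : Equiv.Perm (GenState c r)) (A : Adversary c r) {n : ℕ}
    (hn : A.genQueries ≤ n) (P : List (BitVec r)) :
    idealExpect π A (fun _ _ O => ind (¬(P ++ O).Nodup)) ≤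
      ind (¬P.Nodup) + (P.length * n + n * (n - 1) / 2 : ℝ) / 2 ^ r := by
  induction A generalizing n P with
  | verdict b =>
    have h : (0 : ℝ) ≤ n * (n - 1) := by
      rcases n with _ | n
      · simp
      · push_cast; rw [add_sub_cancel_right]; positivity
    simp only [idealExpect, List.append_nil]
    exact le_add_of_nonneg_right (by positivity)
  | next k ih =>
    obtain ⟨n, rfl⟩ : ∃ m, n = m + 1 := Nat.exists_eq_succ_of_ne_zero fun h => by
      simp [genQueries, h] at hn
    have hk (o : BitVec r) : (k o).genQueries ≤ n :=
      (apply_le_iSup (fun o => (k o).genQueries) o).trans (Nat.le_of_succ_le_succ hn)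
    have hP (o : BitVec r) : ¬(P ++ [o]).Nodup → ¬P.Nodup ∨ o ∈ P := by
      rw [List.nodup_append]
      simp only [List.nodup_singleton, List.mem_singleton]
      intro h
      by_contra h'
      rw [not_or, not_not] at h'
      exact h ⟨h'.1, trivial, fun a ha b hb hab => h'.2 (hb ▸ hab ▸ ha)⟩
    calc idealExpect π (next k) (fun _ _ O => ind (¬(P ++ O).Nodup))
        = 𝔼 o, idealExpect π (k o) (fun _ _ O => ind (¬(P ++ [o] ++ O).Nodup)) := by
          simp only [idealExpect, List.append_assoc, List.singleton_append]
      _ ≤ 𝔼 o, ((ind (¬P.Nodup) + ind (o ∈ P)) +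
            ((P.length + 1) * n + n * (n - 1) / 2 : ℝ) / 2 ^ r) := by
          refine expect_mono fun o => (ih o (hk o) (P ++ [o])).trans ?_
          rw [List.length_append, List.length_singleton, Nat.cast_add, Nat.cast_one]
          gcongr
          exact ind_le_add (hP o)
      _ = ind (¬P.Nodup) + 𝔼 o, ind (o ∈ P) +
            ((P.length + 1) * n + n * (n - 1) / 2 : ℝ) / 2 ^ r := by
          rw [Finset.expect_add_distrib, Finset.expect_add_distrib, Fintype.expect_const,
            Fintype.expect_const]
      _ ≤ ind (¬P.Nodup) + P.length / 2 ^ r +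
            ((P.length + 1) * n + n * (n - 1) / 2 : ℝ) / 2 ^ r := by
          gcongr; exact expect_ind_mem_le P
      _ = _ := by push_cast; ring
  | forward x k ih =>
    exact ih _ ((apply_le_iSup (fun y => (k y).genQueries) _).trans hn) P
  | backward y k ih =>
    exact ih _ ((apply_le_iSup (fun x => (k x).genQueries) _).trans hn) P

/-! ### Good transcripts are at least as likely in the real experiment -/

/-- `L₀` and `M₀` are the pairs revealed so far by permutation queries and by the generator, and
`s` is the current state. In the ideal experiment only `L₀` constrains the permutation; in the real
one `M₀` does too, which the factor accounts for. -/
lemma sum_idealExpect_good_le (A : Adversary c r) (v : Bool) (s : GenState c r)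
    (L₀ M₀ : PairList c r) :
    ∑ π, ind (Extends L₀ π) * idealExpect π A (fun b L O => chainExpect O s fun M =>
        ind (b = v ∧ GoodTranscript (L₀ ++ L) (M₀ ++ M))) ≤
      (Fintype.card (GenState c r) : ℝ) ^ M₀.length *
        ∑ π, ind (Extends (L₀ ++ M₀) π) * ind (A.runReal π s = v) := by
  have hcomm (x y : GenState c r) (L M : PairList c r) (π : Equiv.Perm (GenState c r)) :
      ind (Extends (L ++ M ++ [(x, y)]) π) = ind (Extends (L ++ [(x, y)] ++ M) π) := by
    simp only [extends_append, and_right_comm]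
  induction A generalizing s L₀ M₀ with
  | verdict b =>
    simp only [idealExpect, chainExpect, List.append_nil, runReal, ← Finset.sum_mul]
    by_cases h : b = v ∧ GoodTranscript L₀ M₀
    · rw [ind_of h, ind_of h.1, mul_one, mul_one]
      exact sum_extends_le h.2
    · rw [ind_of_not h, mul_zero]
      exact mul_nonneg (by positivity) (mul_nonneg (Finset.sum_nonneg fun π _ => ind_nonneg _)
        (ind_nonneg _))
  | forward x k ih =>
    have hl := sum_extends_split L₀ (· x) (fun y => (x, y)) (fun _ _ => Iff.rfl) fun π y =>
      idealExpect π (k y) (fun b L O => chainExpect O s fun M =>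
        ind (b = v ∧ GoodTranscript (L₀ ++ (x, y) :: L) (M₀ ++ M)))
    have hr := sum_extends_split (L₀ ++ M₀) (· x) (fun y => (x, y)) (fun _ _ => Iff.rfl)
      fun π y => ind ((k y).runReal π s = v)
    simp only [idealExpect, runReal]
    rw [hl, hr, Finset.mul_sum]
    refine Finset.sum_le_sum fun y _ => ?_
    simp only [hcomm]
    simpa only [List.append_assoc, List.singleton_append] using ih y s (L₀ ++ [(x, y)]) M₀
  | backward y k ih =>
    have hsymm (π : Equiv.Perm (GenState c r)) (x : GenState c r) : π.symm y = x ↔ π x = y := by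
      rw [Equiv.symm_apply_eq, eq_comm]
    have hl := sum_extends_split L₀ (·.symm y) (fun x => (x, y)) hsymm fun π x =>
      idealExpect π (k x) (fun b L O => chainExpect O s fun M =>
        ind (b = v ∧ GoodTranscript (L₀ ++ (x, y) :: L) (M₀ ++ M)))
    have hr := sum_extends_split (L₀ ++ M₀) (·.symm y) (fun x => (x, y)) hsymm
      fun π x => ind ((k x).runReal π s = v)
    simp only [idealExpect, runReal]
    rw [hl, hr, Finset.mul_sum]
    refine Finset.sum_le_sum fun x _ => ?_
    simp only [hcomm]
    simpa only [List.append_assoc, List.singleton_append] using ih x s (L₀ ++ [(x, y)]) M₀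
  | next k ih =>
    have hr := sum_extends_split (L₀ ++ M₀) (· s) (fun z => (s, z)) (fun _ _ => Iff.rfl) fun π z =>
      ind ((k z.2).runReal π (z.1 ^^^ s.1, z.2) = v)
    simp only [idealExpect, chainExpect, runReal, generateStep, idealExpect_expect]
    rw [hr]
    -- The output and the inner half of the answer together form a uniform state `z`.
    have hz (π : Equiv.Perm (GenState c r)) :
        𝔼 o, 𝔼 a, idealExpect π (k o) (fun b L O => chainExpect O (a ^^^ s.1, o) fun M =>
          ind (b = v ∧ GoodTranscript (L₀ ++ L) (M₀ ++ (s, (a, o)) :: M))) =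
        𝔼 z : GenState c r, idealExpect π (k z.2) (fun b L O =>
          chainExpect O (z.1 ^^^ s.1, z.2) fun M =>
            ind (b = v ∧ GoodTranscript (L₀ ++ L) (M₀ ++ (s, z) :: M))) := by
      rw [Finset.expect_comm, ← Finset.univ_product_univ, Finset.expect_product]
    simp only [hz, Finset.mul_expect, ← Finset.expect_sum_comm]
    rw [Fintype.expect_eq_sum_div_card, div_le_iff₀ (by exact_mod_cast Fintype.card_pos),
      mul_right_comm, ← pow_succ, Finset.mul_sum]
    refine Finset.sum_le_sum fun z _ => ?_
    simpa only [List.append_assoc, List.singleton_append, List.length_append,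
      List.length_singleton] using ih z.2 (z.1 ^^^ s.1, z.2) L₀ (M₀ ++ [(s, z)])

/-! ### The advantage -/

lemma toReal_realGame (init : PMF (GenState c r)) (A : Adversary c r) (v : Bool) :
    (A.realGame init v).toReal = 𝔼 π, ∑ s, (init s).toReal * ind (A.runReal π s = v) := by
  rw [realGame, toReal_uniform_bind]
  exact Finset.expect_congr rfl fun π _ => toReal_map_apply _ _ _

lemma toReal_idealGame (A : Adversary c r) (v : Bool) :
    (A.idealGame v).toReal = 𝔼 π, idealExpect π A fun b _ _ => ind (b = v) := by
  rw [idealGame, toReal_uniform_bind]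
  exact Finset.expect_congr rfl fun π _ => toReal_runIdeal _ _ _

/-- The probability of a bad transcript in the ideal experiment with the permutation `π`. -/
lemma sum_idealExpect_not_good_le (init : PMF (GenState c r)) {δ : ℝ}
    (hδ : ∀ s, (init s).toReal ≤ δ) (A : Adversary c r) (π : Equiv.Perm (GenState c r)) :
    ∑ s, (init s).toReal * idealExpect π A (fun _ L O => chainExpect O s fun M =>
        ind (¬GoodTranscript L M)) ≤
      A.permQueries * (δ + 2 / 2 ^ c) + (A.genQueries : ℝ) * (A.genQueries + 1) / 2 / 2 ^ r := by
  have hδ₀ : 0 ≤ δ := ENNReal.toReal_nonneg.trans (hδ 0)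
  have hlist (L : PairList c r) :
      ∑ s, (init s).toReal * (L.map fun p => ind (s = p.1)).sum ≤ δ * L.length := by
    induction L with
    | nil => simp
    | cons p L ih =>
      have hp := sum_ind_eq_mul p.1 fun s => (init s).toReal
      simp only [List.map_cons, List.sum_cons, mul_add, Finset.sum_add_distrib, List.length_cons]
      simp only [mul_comm (ind _), eq_comm (a := p.1)] at hp
      rw [hp]
      push_cast
      linarith [hδ p.1]
  have hstart (s : GenState c r) :
      idealExpect π A (fun _ _ O => ind (¬(s.2 :: O).Nodup)) ≤
        (A.genQueries : ℝ) * (A.genQueries + 1) / 2 / 2 ^ r := by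
    refine (idealExpect_not_nodup_le π A le_rfl [s.2]).trans_eq ?_
    rw [ind_of_not (not_not.mpr (List.nodup_singleton _)), List.length_singleton]
    push_cast
    ring
  have hlen := idealExpect_length_le π A
  calc ∑ s, (init s).toReal * idealExpect π A (fun _ L O => chainExpect O s fun M =>
        ind (¬GoodTranscript L M))
      ≤ ∑ s, (init s).toReal * ((A.genQueries : ℝ) * (A.genQueries + 1) / 2 / 2 ^ r +
          idealExpect π A (fun _ L _ => (L.map fun p => ind (s = p.1)).sum +
            L.length * (2 / 2 ^ c))) := by
        gcongr with s
        refine (idealExpect_mono π A fun _ L O => chainExpect_not_good_le O s L).trans ?_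
        rw [idealExpect_add]
        gcongr
        exact hstart s
    _ = (A.genQueries : ℝ) * (A.genQueries + 1) / 2 / 2 ^ r +
          idealExpect π A (fun _ L _ => ∑ s, (init s).toReal *
            ((L.map fun p => ind (s = p.1)).sum + L.length * (2 / 2 ^ c))) := by
        rw [idealExpect_sum π A (fun s => (init s).toReal) fun s _ L _ =>
          (L.map fun p => ind (s = p.1)).sum + L.length * (2 / 2 ^ c)]
        simp only [mul_add (ENNReal.toReal _), Finset.sum_add_distrib, ← Finset.sum_mul,
          sum_toReal_pmf, one_mul]
    _ ≤ (A.genQueries : ℝ) * (A.genQueries + 1) / 2 / 2 ^ r +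
          idealExpect π A (fun _ L _ => (δ + 2 / 2 ^ c) * (L.length : ℝ)) := by
        gcongr
        refine idealExpect_mono π A fun _ L _ => ?_
        simp only [mul_add (ENNReal.toReal _), Finset.sum_add_distrib, ← Finset.sum_mul,
          sum_toReal_pmf, one_mul]
        linarith [hlist L]
    _ ≤ _ := by
        rw [idealExpect_const_mul, add_comm, mul_comm (A.permQueries : ℝ)]
        gcongr

/-- Good transcripts are at least as likely in the real experiment, so a verdict loses at most the
probability of the bad ones. -/
lemma idealGame_le_realGame_add (init : PMF (GenState c r)) {δ : ℝ}
    (hδ : ∀ s, (init s).toReal ≤ δ) (A : Adversary c r) (v : Bool) :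
    (A.idealGame v).toReal ≤ (A.realGame init v).toReal +
      (A.permQueries * (δ + 2 / 2 ^ c) +
        (A.genQueries : ℝ) * (A.genQueries + 1) / 2 / 2 ^ r) := by
  -- The good transcripts with verdict `v`, from the initial state `s`.
  have hgood (s : GenState c r) :
      𝔼 π, idealExpect π A (fun b L O => chainExpect O s fun M =>
          ind (b = v ∧ GoodTranscript L M)) ≤
        𝔼 π, ind (A.runReal π s = v) := by
    have h := sum_idealExpect_good_le A v s [] []
    have hnil (π : Equiv.Perm (GenState c r)) : ind (Extends [] π) = 1 :=
      ind_of (by simp [Extends])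
    simp only [List.nil_append, hnil, one_mul, List.length_nil, pow_zero] at h
    rw [Fintype.expect_eq_sum_div_card, Fintype.expect_eq_sum_div_card]
    gcongr
  have hsplit (π : Equiv.Perm (GenState c r)) (s : GenState c r) :
      idealExpect π A (fun b _ _ => ind (b = v)) ≤
        idealExpect π A (fun b L O => chainExpect O s fun M =>
          ind (b = v ∧ GoodTranscript L M)) +
        idealExpect π A (fun _ L O => chainExpect O s fun M => ind (¬GoodTranscript L M)) := by
    rw [← idealExpect_add]
    refine idealExpect_mono π A fun b L O => ?_
    rw [← chainExpect_add, ← chainExpect_const O s (ind (b = v))]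
    exact chainExpect_mono O s fun M _ _ => ind_le_add fun h => by tauto
  calc (A.idealGame v).toReal
      = 𝔼 π, ∑ s, (init s).toReal * idealExpect π A (fun b _ _ => ind (b = v)) := by
        simp only [toReal_idealGame, ← Finset.sum_mul, sum_toReal_pmf, one_mul]
    _ ≤ 𝔼 π, (∑ s, (init s).toReal * idealExpect π A (fun b L O => chainExpect O s fun M =>
            ind (b = v ∧ GoodTranscript L M)) +
          ∑ s, (init s).toReal * idealExpect π A (fun _ L O => chainExpect O s fun M =>
            ind (¬GoodTranscript L M))) := by
        refine expect_mono fun π => ?_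
        rw [← Finset.sum_add_distrib]
        refine Finset.sum_le_sum fun s _ => ?_
        rw [← mul_add]
        gcongr
        exact hsplit π s
    _ ≤ _ := by
        rw [Finset.expect_add_distrib, toReal_realGame]
        refine add_le_add ?_ ((expect_mono
          (sum_idealExpect_not_good_le init hδ A)).trans_eq (Fintype.expect_const _))
        simp only [Finset.expect_sum_comm, ← Finset.mul_expect]
        exact Finset.sum_le_sum fun s _ => mul_le_mul_of_nonneg_left (hgood s)
          ENNReal.toReal_nonneg

/-- `idealGame_le_realGame_add` for both verdicts at once: since the two probabilities sum to one in
each experiment, the bound for `false` is the reverse bound for `true`. -/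
lemma advantage_le (init : PMF (GenState c r)) {δ : ℝ} (hδ : ∀ s, (init s).toReal ≤ δ)
    (A : Adversary c r) :
    A.advantage init ≤ A.permQueries * (δ + 2 / 2 ^ c) +
      (A.genQueries : ℝ) * (A.genQueries + 1) / 2 / 2 ^ r := by
  have hr := sum_toReal_pmf (A.realGame init)
  have hi := sum_toReal_pmf A.idealGame
  rw [Fintype.sum_bool] at hr hi
  have ht := idealGame_le_realGame_add init hδ A true
  have hf := idealGame_le_realGame_add init hδ A false
  rw [advantage, abs_le]
  constructor <;> linarith

lemma advantage_le_sq (init : PMF (GenState c r)) {δ : ℝ} (hδ : ∀ s, (init s).toReal ≤ δ)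
    (A : Adversary c r) :
    A.advantage init ≤ A.permQueries * (δ + 2 / 2 ^ c) + (A.genQueries : ℝ) ^ 2 / 2 ^ r := by
  refine (advantage_le init hδ A).trans ?_
  gcongr
  -- `ℓ (ℓ + 1) / 2 ≤ ℓ ^ 2` because `ℓ` is a natural number.
  have h : (A.genQueries : ℝ) ≤ (A.genQueries : ℝ) ^ 2 := by
    exact_mod_cast Nat.le_self_pow two_ne_zero _
  linarith

end Adversary

theorem mainTheorem3 :
    -- uniformly random initial state
    (∀ A : Adversary 128 1920, A.permQueries ≤ 2 ^ 64 → A.genQueries ≤ 2 ^ 64 →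
      A.advantage (PMF.uniformOfFintype (GenState 128 1920)) ≤ 1 / 2 ^ 62) ∧
    -- secret permutation, any initial state
    (∀ (init : PMF (GenState 128 1920)) (A : Adversary 128 1920),
      A.permQueries = 0 → A.genQueries ≤ 2 ^ 64 →
      A.advantage init ≤ 1 / 2 ^ 1792) ∧
    -- the concrete bound, for any initial distribution and any numbers of queries
    (∀ (init : PMF (GenState 128 1920)) (δ : ℝ), (∀ s, (init s).toReal ≤ δ) →
      ∀ A : Adversary 128 1920,
        A.advantage init ≤
          (A.permQueries : ℝ) * (δ + 1 / 2 ^ 127) + (A.genQueries : ℝ) ^ 2 / 2 ^ 1920) := by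
  have key (init : PMF (GenState 128 1920)) (δ : ℝ) (hδ : ∀ s, (init s).toReal ≤ δ)
      (A : Adversary 128 1920) : A.advantage init ≤
        (A.permQueries : ℝ) * (δ + 1 / 2 ^ 127) + (A.genQueries : ℝ) ^ 2 / 2 ^ 1920 := by
    have h2 : (2 : ℝ) / 2 ^ 128 = 1 / 2 ^ 127 := by norm_num
    exact h2 ▸ Adversary.advantage_le_sq init hδ A
  have hgen (A : Adversary 128 1920) (hA : A.genQueries ≤ 2 ^ 64) :
      (A.genQueries : ℝ) ^ 2 / 2 ^ 1920 ≤ 1 / 2 ^ 1792 := by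
    have hA' : (A.genQueries : ℝ) ≤ 2 ^ 64 := by exact_mod_cast hA
    have hp : (2 : ℝ) ^ 1920 = (2 ^ 64) ^ 2 * 2 ^ 1792 := by rw [← pow_mul, ← pow_add]
    rw [hp, ← div_div]
    gcongr
    exact div_le_one_of_le₀ (by gcongr) (by positivity)
  refine ⟨fun A hq hl => ?_, fun init A hq hl => ?_, key⟩
  · have hδ (s : GenState 128 1920) :
        (PMF.uniformOfFintype (GenState 128 1920) s).toReal ≤ 1 / 2 ^ 128 := by
      rw [PMF.uniformOfFintype_apply, ENNReal.toReal_inv, ENNReal.toReal_natCast,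
        Fintype.card_prod, Nat.cast_mul, card_bitVec, card_bitVec, one_div]
      gcongr
      exact le_mul_of_one_le_right (by positivity) (one_le_pow₀ one_le_two)
    have hq' : (A.permQueries : ℝ) ≤ 2 ^ 64 := by exact_mod_cast hq
    have hsmall : (1 : ℝ) / 2 ^ 1792 ≤ 1 / 2 ^ 64 := by
      gcongr <;> norm_num
    calc A.advantage (PMF.uniformOfFintype (GenState 128 1920))
        ≤ (A.permQueries : ℝ) * (1 / 2 ^ 128 + 1 / 2 ^ 127) +
            (A.genQueries : ℝ) ^ 2 / 2 ^ 1920 := key _ _ hδ A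
      _ ≤ 2 ^ 64 * (1 / 2 ^ 128 + 1 / 2 ^ 127) + 1 / 2 ^ 64 := by
          exact add_le_add (by gcongr) ((hgen A hl).trans hsmall)
      _ ≤ 1 / 2 ^ 62 := by norm_num
  · have h := key init 1 (fun s => ENNReal.toReal_le_of_le_ofReal zero_le_one
      (by simpa using init.coe_le_one s)) A
    rw [hq, Nat.cast_zero, zero_mul, zero_add] at h
    exact h.trans (hgen A hl)
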